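/- **Setting.** There are $n$ processes $p_1,\dots,p_n$ in a synchronous network with point-to-point links: in each round every process sends messages (at most one per recipient), receives messages, and updates its local state. An arbitrary set of $f$ processes is Byzantine (sends arbitrary messages); the others are honest and follow a deterministic protocol without cryptography. Each process $p_i$ receives a prediction string $a_i\in\{0,1\}^n$, where $a_i[j]=1$ means that $p_i$ predicts $p_j$ to be honest and $a_i[j]=0$ that it predicts $p_j$ to be Byzantine. Let $B$ be the number of pairs $(i,j)$ such that $p_i$ is honest and $a_i[j]$ is wrong about $p_j$. A process $p_j$ is *misclassified* if it is Byzantine and at least $n/2-f$ honest processes predict it as honest, or it is honest and at least $n-f-n/2$ honest processes predict it as Byzantine. A set $G$ of processes is *$\frac12$-good* if no member of $G$ is misclassified and fewer than $\lceil |G|/2\rceil$ members of $G$ are Byzantine. In *group leader election* every process $p_i$ gets the same group $G$ and its own string $a_i$ as input, and all honest processes must output the same process, which must be an honest member of $G$. **Lemma.** There are absolute constants $R,M$ such that for all constants $0<\varepsilon<\frac12$, $c>0$, $D>0$ there are a constant $K=K(\varepsilon,c,D)$ and, for each $n$, a protocol for $n$ processes (depending only on $n,\varepsilon,c,D$), with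 the following properties. 1. (Correctness) In every execution in which $G$ is $\frac12$-good, $f<(\frac12-\varepsilon)n$, and $$|G|\ge c\sqrt n\ \Longrightarrow\ B\le D\,n^{1.5},$$ the protocol solves group leader election: all honest processes output the same honest member of $G$. 2. (Complexity) In every execution, for any group $G$ given to all processes, all honest processes output within $R$ rounds, and over the entire execution honest processes send at most $M\,n|G|$ messages and at most $K\,n^{1.5}|G|\log n$ bits. That is, the protocol uses $O(1)$ rounds, $O(n|G|)$ messages and $O(n^{1.5}|G|\log n)$ bits. -/

import Mathlib

/-! Synchronous Byzantine message passing with classification predictions.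
The processes are the elements of `Fin n`. -/

namespace ByzPred

/-- A message is a bit string; its size in bits is its length. -/
abbrev Message : Type := List Bool

/-- A deterministic synchronous protocol for `n` processes that takes as input a group of
processes and a prediction string. In every round each process sends at most one message to each
process, as determined by its local state, and then updates its state from what it received
(`none`: nothing was sent on that link). An output is irrevocable. -/
structure Protocol (n : ℕ) where
  /-- local states -/
  State : Type
  /-- initial state of a process, from its identity, the group and its own prediction string -/
  init : Fin n → Finset (Fin n) → (Fin n → Bool) → State
  /-- `send s j` is the message sent to `j` in a round that starts in state `s` -/
  send : State → Fin n → Option Message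
  /-- `step s m` is the next state, where `m j` is what was received from `j` in the round -/
  step : State → (Fin n → Option Message) → State
  /-- the output, once there is one -/
  output : State → Option (Fin n)
  /-- outputs are irrevocable -/
  output_step : ∀ s m v, output s = some v → output (step s m) = some v

/-- Everything outside the control of the protocol: the set of Byzantine processes, the group
given to all processes, the prediction strings (`prediction i j = true` iff `i` predicts `j` to be
honest), and the messages of the Byzantine processes (`adversary r i j` is what `i` sends to `j` in
round `r`). Protocols are deterministic, so quantifying over all such message assignments covers
every adaptive adversary strategy. -/
structure Scenario (n : ℕ) where
  /-- the Byzantine processes -/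
  faulty : Finset (Fin n)
  /-- the group -/
  group : Finset (Fin n)
  /-- the prediction strings -/
  prediction : Fin n → Fin n → Bool
  /-- what the Byzantine processes send -/
  adversary : ℕ → Fin n → Fin n → Option Message

namespace Scenario

variable {n : ℕ} (e : Scenario n)

/-- The set of honest processes. -/
def honest : Finset (Fin n) := Finset.univ \ e.faulty

/-- The number `f` of Byzantine processes. -/
def f : ℕ := e.faulty.card

/-- The number `B` of wrong prediction bits of honest processes. -/
def B : ℕ :=
  ((e.honest ×ˢ (Finset.univ : Finset (Fin n))).filter
    (fun p => (e.prediction p.1 p.2 = false ∧ p.2 ∈ e.honest) ∨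
      (e.prediction p.1 p.2 = true ∧ p.2 ∈ e.faulty))).card

/-- `j` is Byzantine and at least `n/2 - f` honest processes predict it as honest, or `j` is honest
and at least `n - f - n/2` honest processes predict it as Byzantine. -/
def Misclassified (j : Fin n) : Prop :=
  (j ∈ e.faulty ∧
    (n : ℝ) / 2 - (e.f : ℝ) ≤ ((e.honest.filter (fun i => e.prediction i j = true)).card : ℝ)) ∨
  (j ∈ e.honest ∧
    (n : ℝ) - (e.f : ℝ) - (n : ℝ) / 2 ≤
      ((e.honest.filter (fun i => e.prediction i j = false)).card : ℝ))

/-- The group is `c`-good: no member is misclassified, and fewer than `⌈c |G|⌉` members are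
Byzantine. -/
def IsGood (c : ℝ) : Prop :=
  (∀ j ∈ e.group, ¬ e.Misclassified j) ∧
  (e.group ∩ e.faulty).card < ⌈c * (e.group.card : ℝ)⌉₊

end Scenario

namespace Protocol

variable {n : ℕ} (P : Protocol n) (e : Scenario n)

/-- The local state of each process after `r` rounds. (The states attached to Byzantine processes
play no role.) -/
def state : ℕ → Fin n → P.State
  | 0 => fun i => P.init i e.group (e.prediction i)
  | r + 1 => fun i => P.step (state r i)
      (fun j => if j ∈ e.faulty then e.adversary r j i else P.send (state r j) i)

/-- Process `i` outputs `v` at some time. -/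
def Outputs (i v : Fin n) : Prop :=
  ∃ r, P.output (P.state e r i) = some v

/-- All honest processes have an output after `R` rounds. -/
def TerminatesBy (R : ℕ) : Prop :=
  ∀ i ∈ e.honest, ∃ v, P.output (P.state e R i) = some v

/-- The number of messages that honest processes send in the first `T` rounds. -/
def messages (T : ℕ) : ℕ :=
  ∑ r ∈ Finset.range T, ∑ i ∈ e.honest, ∑ j : Fin n,
    (P.send (P.state e r i) j).elim 0 (fun _ => 1)

/-- The number of bits that honest processes send in the first `T` rounds. -/
def bits (T : ℕ) : ℕ :=
  ∑ r ∈ Finset.range T, ∑ i ∈ e.honest, ∑ j : Fin n,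
    (P.send (P.state e r i) j).elim 0 List.length

/-- The requirements of group leader election: every honest process outputs, all honest processes
output the same process (agreement), and it is an honest member of the group (validity). -/
def ElectsLeader : Prop :=
  (∀ i ∈ e.honest, ∃ v, P.Outputs e i v) ∧
  (∀ i ∈ e.honest, ∀ j ∈ e.honest, ∀ u v, P.Outputs e i u → P.Outputs e j v → u = v) ∧
  (∀ i ∈ e.honest, ∀ v, P.Outputs e i v → v ∈ e.group ∧ v ∈ e.honest)

end Protocol

end ByzPred

/-! Every process sends each member g of G a hash of about √n log n bits of its prediction string.
From these g searches for any scenario satisfying the promises that explains the hashes it received,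
and trusts the honest processes of that scenario. The true scenario is a candidate, so one is found;
it may be wrong, but only mildly. If the strings of many processes honest in both scenarios
coincide, a process whose status is disputed collects too many wrong predictions in one of them. The
hash contains the exact predictions about a block of about √n members around g, so g is right about
its own block (`IsGood.honest_iff`). For large groups the rest of the hash recovers the strings
themselves (`eq_of_hash_eq`): most rows have O(√n) errors, so syndromes force the difference of the
true and explained strings to be one common vector, and the shares, pooled over εn processes, force
that vector to be zero. Then g errs only about members of the set `doubtful`, which has size O(√n)
and does not depend on g (`IsGood.honest_iff_of_hash_eq`). Honest members of a block hence nominate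
the same honest process, and thresholds exceeding the size of the doubtful set give all honest
members of G the same nonempty set of nominees (`electsLeader`). The honest majority of G announces
the least one. -/

namespace ByzPred

/-! ### Hashing prediction strings -/

/-- A finite type with at most `2 ^ l` elements embeds into the bit strings of length `l`. -/
theorem exists_encoding (α : Type) [Fintype α] (l : ℕ) (h : Fintype.card α ≤ 2 ^ l) :
    ∃ enc : α → Message, Function.Injective enc ∧ ∀ x, (enc x).length = l := by
  have h' : Fintype.card α ≤ Fintype.card (Fin l → Bool) := by simpa using h
  obtain ⟨φ⟩ := Function.Embedding.nonempty_of_card_le h'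
  exact ⟨fun x => List.ofFn (φ x), fun x y hxy => φ.injective (List.ofFn_injective hxy),
    fun x => by simp⟩

/-- A bit as a field element. -/
def bit (F : Type) [Field F] (x : Bool) : F := if x then 1 else 0

theorem bit_injective (F : Type) [Field F] : Function.Injective (bit F) := by
  intro x y h
  cases x <;> cases y <;> simp_all [bit]

/-- The first `K` power sums of a bit string, weighted by its positions. -/
def syndrome (F : Type) [Field F] {n : ℕ} (K : ℕ) (a : Fin n → Bool) : Fin K → F :=
  fun s => ∑ j, bit F (a j) * ((j : ℕ) : F) ^ (s : ℕ)

/-- The values, at `m` points belonging to `i`, of the polynomial with coefficients `a`. -/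
def share (F : Type) [Field F] {n : ℕ} (m : ℕ) (i : Fin n) (a : Fin n → Bool) : Fin m → F :=
  fun s => ∑ j, bit F (a j) * ((i * m + s : ℕ) : F) ^ (j : ℕ)

/-- A vector of weight at most `K` is determined by its first `K` weighted power sums. -/
theorem eq_zero_of_powerSums {F ι : Type} [Field F] [Fintype ι] [DecidableEq ι] (β : ι → F)
    (hβ : Function.Injective β) (v : ι → F) (K : ℕ) (S : Finset ι) (hS : S.card ≤ K)
    (hv : ∀ j, j ∉ S → v j = 0) (h : ∀ s < K, ∑ j, v j * β j ^ s = 0) : v = 0 := by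
  classical
  have key : ∀ P : Polynomial F, P.natDegree < K → ∑ j, v j * P.eval (β j) = 0 := by
    intro P hP
    simp_rw [Polynomial.eval_eq_sum_range' hP, Finset.mul_sum]
    rw [Finset.sum_comm]
    refine Finset.sum_eq_zero fun s hs => ?_
    have := h s (Finset.mem_range.1 hs)
    calc ∑ j, v j * (P.coeff s * β j ^ s) = P.coeff s * ∑ j, v j * β j ^ s := by
          rw [Finset.mul_sum]; exact Finset.sum_congr rfl fun j _ => by ring
      _ = 0 := by rw [this, mul_zero]
  funext j
  by_cases hj : j ∈ S
  -- This test polynomial kills every coordinate of S except j, which isolates `v j`.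
  · have hdeg : (∏ i ∈ S.erase j, (Polynomial.X - Polynomial.C (β i))).natDegree < K := by
      rw [Polynomial.natDegree_prod_of_monic _ _ fun i _ => Polynomial.monic_X_sub_C _]
      simp only [Polynomial.natDegree_X_sub_C, Finset.sum_const, smul_eq_mul, mul_one]
      exact (Finset.card_erase_lt_of_mem hj).trans_le hS
    have := key _ hdeg
    rw [Finset.sum_eq_single j] at this
    · rcases mul_eq_zero.1 this with h0 | h0
      · exact h0
      · exfalso
        rw [Polynomial.eval_prod, Finset.prod_eq_zero_iff] at h0
        obtain ⟨i, hi, h0⟩ := h0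
        simp only [Polynomial.eval_sub, Polynomial.eval_X, Polynomial.eval_C, sub_eq_zero] at h0
        exact (Finset.mem_erase.1 hi).1 (hβ h0).symm
    · intro i _ hij
      by_cases hi : i ∈ S
      · rw [Polynomial.eval_prod, Finset.prod_eq_zero (Finset.mem_erase.2 ⟨hij, hi⟩) (by simp),
          mul_zero]
      · rw [hv i hi, zero_mul]
    · simp
  · exact hv j hj

/-- A vector of length `n` whose polynomial vanishes at all the points of at least `n / m`
processes is zero. -/
theorem eq_zero_of_shares {p : ℕ} [Fact p.Prime] {n m : ℕ} (hp : n * m ≤ p)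
    (I : Finset (Fin n)) (hI : n ≤ I.card * m) (x : Fin n → ZMod p)
    (h : ∀ i ∈ I, ∀ s : Fin m, ∑ j, x j * ((i * m + s : ℕ) : ZMod p) ^ (j : ℕ) = 0) : x = 0 := by
  classical
  rcases Nat.eq_zero_or_pos n with rfl | hn
  · exact Subsingleton.elim _ _
  set P : Polynomial (ZMod p) := ∑ j : Fin n, Polynomial.monomial (j : ℕ) (x j) with hP
  have hdeg : P.natDegree < n := by
    refine lt_of_le_of_lt (Polynomial.natDegree_sum_le_of_forall_le _ _ (n := n - 1) ?_)
      (by omega)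
    intro j _
    exact (Polynomial.natDegree_monomial_le _).trans (by omega)
  let pt : I × Fin m → ZMod p := fun q => (((q.1 : Fin n) * m + q.2 : ℕ) : ZMod p)
  have hlt : ∀ q : I × Fin m, ((q.1 : Fin n) : ℕ) * m + q.2 < p := by
    intro q
    have h1 := q.1.1.2
    have h2 := q.2.2
    calc ((q.1 : Fin n) : ℕ) * m + q.2 < (((q.1 : Fin n) : ℕ) + 1) * m := by
          rw [add_mul]; omega
      _ ≤ n * m := Nat.mul_le_mul_right _ h1
      _ ≤ p := hp
  -- The points i m + s with s < m are distinct integers below n m ≤ p, so they stay distinct modulo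
  -- p.
  have hpt : Function.Injective pt := by
    intro q q' hq
    have h1 : ((q.1 : Fin n) : ℕ) * m + q.2 = ((q'.1 : Fin n) : ℕ) * m + q'.2 := by
      have := (ZMod.natCast_eq_natCast_iff' _ _ _).1 hq
      rwa [Nat.mod_eq_of_lt (hlt q), Nat.mod_eq_of_lt (hlt q')] at this
    have hm : 0 < m := lt_of_le_of_lt (Nat.zero_le _) q.2.2
    have h2 : ((q.1 : Fin n) : ℕ) = ((q'.1 : Fin n) : ℕ) := by
      have := congrArg (· / m) h1
      simpa [Nat.mul_add_div hm, mul_comm _ m, Nat.div_eq_of_lt q.2.2, Nat.div_eq_of_lt q'.2.2]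
        using this
    rw [h2] at h1
    exact Prod.ext (Subtype.ext (Fin.ext h2)) (Fin.ext (by omega))
  have hP0 : P = 0 := by
    refine Polynomial.eq_zero_of_natDegree_lt_card_of_eval_eq_zero P hpt ?_ ?_
    · intro q
      rw [hP, Polynomial.eval_finsetSum]
      simpa [pt, Polynomial.eval_monomial] using h q.1.1 q.1.2 q.2
    · simpa using hdeg.trans_le hI
  funext j
  have := congrArg (fun Q => Polynomial.coeff Q (j : ℕ)) hP0
  simpa [hP, Polynomial.finsetSum_coeff, Polynomial.coeff_monomial, Fin.val_inj] using this

/-- Two families of bit strings with equal hashes coincide, provided that the differences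
between the two families vary only in few places. -/
theorem eq_of_hash_eq {p : ℕ} [Fact p.Prime] {n m K : ℕ} (hm : 0 < m) (hp : n * m ≤ p)
    (I : Finset (Fin n)) (hI : n ≤ I.card * m) (a a' : Fin n → Fin n → Bool)
    (E : Fin n → Finset (Fin n)) (hE : ∀ i ∈ I, ∀ i' ∈ I, (E i ∪ E i').card ≤ K)
    (hsupp : ∀ i ∈ I, ∀ i' ∈ I, ∀ j, j ∉ E i ∪ E i' → a i j = a i' j ∧ a' i j = a' i' j)
    (hsyn : ∀ i ∈ I, syndrome (ZMod p) K (a i) = syndrome (ZMod p) K (a' i))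
    (hsh : ∀ i ∈ I, share (ZMod p) m i (a i) = share (ZMod p) m i (a' i)) :
    ∀ i ∈ I, a i = a' i := by
  classical
  set x : Fin n → Fin n → ZMod p := fun i j => bit (ZMod p) (a i j) - bit (ZMod p) (a' i j) with hx
  have hxs : ∀ i ∈ I, ∀ s < K, ∑ j, x i j * ((j : ℕ) : ZMod p) ^ s = 0 := by
    intro i hi s hs
    have := congrFun (hsyn i hi) ⟨s, hs⟩
    simp only [syndrome] at this
    simp only [hx, sub_mul, Finset.sum_sub_distrib, this, sub_self]
  -- A single `x i` may have large weight; only differences of two of them are sparse enough for the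
  -- syndrome.
  have hconst : ∀ i ∈ I, ∀ i' ∈ I, x i = x i' := by
    intro i hi i' hi'
    have : x i - x i' = 0 := by
      refine eq_zero_of_powerSums (fun j : Fin n => ((j : ℕ) : ZMod p)) ?_ _ K (E i ∪ E i')
        (hE i hi i' hi') ?_ ?_
      · intro j j' hj
        have hjp : ∀ j : Fin n, (j : ℕ) < p := fun j =>
          j.2.trans_le ((Nat.le_mul_of_pos_right n hm).trans hp)
        have := (ZMod.natCast_eq_natCast_iff' _ _ _).1 hj
        rw [Nat.mod_eq_of_lt (hjp j), Nat.mod_eq_of_lt (hjp j')] at this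
        exact Fin.ext this
      · intro j hj
        obtain ⟨h1, h2⟩ := hsupp i hi i' hi' j hj
        simp [hx, h1, h2]
      · intro s hs
        simp only [Pi.sub_apply, sub_mul, Finset.sum_sub_distrib, hxs i hi s hs, hxs i' hi' s hs,
          sub_self]
    exact sub_eq_zero.1 this
  intro i hi
  have hx0 : x i = 0 := by
    refine eq_zero_of_shares hp I hI (x i) fun i' hi' s => ?_
    have := congrFun (hsh i' hi') s
    simp only [share] at this
    rw [hconst i hi i' hi']
    simp only [hx, sub_mul, Finset.sum_sub_distrib, this, sub_self]
  funext j
  exact bit_injective (ZMod p) (sub_eq_zero.1 (congrFun hx0 j))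


/-! ### The protocol -/

/-- The least element of a set of processes, or `d` if it is empty. -/
def pick {n : ℕ} (d : Fin n) (S : Finset (Fin n)) : Fin n :=
  if h : S.Nonempty then S.min' h else d

theorem pick_mem {n : ℕ} (d : Fin n) {S : Finset (Fin n)} (h : S.Nonempty) : pick d S ∈ S := by
  rw [pick, dif_pos h]; exact S.min'_mem h

theorem pick_congr {n : ℕ} (d d' : Fin n) {S : Finset (Fin n)} (h : S.Nonempty) :
    pick d S = pick d' S := by
  rw [pick, pick, dif_pos h, dif_pos h]

/-- The ingredients of the leader election protocol. -/
structure Design (n : ℕ) where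
  /-- `hash G i g a` is what process `i` with prediction string `a` tells the member `g` of `G` -/
  hash : Finset (Fin n) → Fin n → Fin n → (Fin n → Bool) → Message
  /-- the set of processes that `g` trusts after receiving the hashes -/
  infer : Finset (Fin n) → Fin n → (Fin n → Option Message) → Finset (Fin n)
  /-- the block of the group to which a member belongs -/
  block : Finset (Fin n) → Fin n → Finset (Fin n)
  /-- a bound on the number of members about which honest members may err -/
  slack : Finset (Fin n) → ℕ
  /-- the message that names a process -/
  name : Fin n → Message

/-- The local states of the protocol. -/
structure LocalState (n : ℕ) where
  /-- the number of completed rounds, at most 3 -/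
  round : ℕ
  /-- the process itself -/
  me : Fin n
  /-- the group -/
  group : Finset (Fin n)
  /-- the prediction string -/
  pred : Fin n → Bool
  /-- the processes inferred to be honest -/
  trusted : Finset (Fin n)
  /-- the current choice of a leader -/
  leader : Fin n

namespace Design

variable {n : ℕ} (d : Design n)

/-- The process that a member `g` of `G` that trusts `T` nominates: the first trusted member of its
block, if the block has enough trusted members. -/
def claim (G T : Finset (Fin n)) (g : Fin n) : Option (Fin n) :=
  -- Even after losing `slack` members that a receiver misjudges, such a block supplies more than
  -- `slack` nominations, the cutoff in `nominees`.
  if 2 * d.slack G + 1 ≤ (d.block G g ∩ T).card then some (pick g (d.block G g ∩ T)) else none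

/-- The processes nominated by more trusted members than may be trusted wrongly. -/
def nominees (G T : Finset (Fin n)) (m : Fin n → Option Message) : Finset (Fin n) :=
  Finset.univ.filter fun v =>
    d.slack G < ((G ∩ T).filter fun j => m j = some (d.name v)).card

open Classical in
/-- The process named by a majority of `G`, or `i` if there is none. -/
noncomputable def majority (G : Finset (Fin n)) (i : Fin n) (m : Fin n → Option Message) : Fin n :=
  if h : ∃ v, G.card < 2 * (G.filter fun j => m j = some (d.name v)).card then h.choose else i

/-- What is sent in the three rounds: hashes to the members of the group, then nominations and
finally the leader to all processes. -/
def sendMsg (s : LocalState n) (j : Fin n) : Option Message :=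
  if s.round = 0 then (if j ∈ s.group then some (d.hash s.group s.me j s.pred) else none)
  else if s.me ∈ s.group then
    (if s.round = 1 then (d.claim s.group s.trusted s.me).map d.name
    else if s.round = 2 then some (d.name s.leader) else none)
  else none

/-- The transition function. -/
noncomputable def next (s : LocalState n) (m : Fin n → Option Message) : LocalState n :=
  if s.round = 0 then { s with round := 1, trusted := d.infer s.group s.me m }
  else if s.round = 1 then
    { s with round := 2, leader := pick s.me (d.nominees s.group s.trusted m) }
  else if s.round = 2 then { s with round := 3, leader := d.majority s.group s.me m }
  else s

/-- The three-round leader election protocol. -/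
noncomputable def protocol : Protocol n where
  State := LocalState n
  init i G a := ⟨0, i, G, a, ∅, i⟩
  send := d.sendMsg
  step := d.next
  output s := if s.round = 3 then some s.leader else none
  output_step s m v h := by
    by_cases h3 : s.round = 3
    · simpa [next, h3] using h
    · simp [h3] at h

/-! ### Executions of the protocol: states, messages, cost, correctness. -/

variable (e : Scenario n)

/-- What `i` receives from `j` in round `r`. -/
noncomputable def received (r : ℕ) (i j : Fin n) : Option Message :=
  if j ∈ e.faulty then e.adversary r j i else d.sendMsg (d.protocol.state e r j) i

theorem state_zero (i : Fin n) :
    d.protocol.state e 0 i = ⟨0, i, e.group, e.prediction i, ∅, i⟩ := rfl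

theorem state_succ (r : ℕ) (i : Fin n) :
    d.protocol.state e (r + 1) i = d.next (d.protocol.state e r i) (d.received e r i) := rfl

/-- The set of processes that `i` trusts after the first round. -/
noncomputable def trust (i : Fin n) : Finset (Fin n) := d.infer e.group i (d.received e 0 i)

/-- The process that `i` regards as leader after the second round. -/
noncomputable def proposal (i : Fin n) : Fin n :=
  pick i (d.nominees e.group (d.trust e i) (d.received e 1 i))

theorem state_one (i : Fin n) :
    d.protocol.state e 1 i = ⟨1, i, e.group, e.prediction i, d.trust e i, i⟩ := by
  simp [state_succ, state_zero, next, trust]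
  rfl

theorem state_two (i : Fin n) : d.protocol.state e 2 i =
    ⟨2, i, e.group, e.prediction i, d.trust e i, d.proposal e i⟩ := by
  rw [state_succ, state_one]
  simp [next, proposal]
  rfl

theorem state_three (r : ℕ) (i : Fin n) : d.protocol.state e (3 + r) i =
    ⟨3, i, e.group, e.prediction i, d.trust e i, d.majority e.group i (d.received e 2 i)⟩ := by
  induction r with
  | zero =>
    rw [state_succ, state_two]
    simp [next]
    rfl
  | succ r ih =>
    rw [← add_assoc, state_succ, ih]
    simp [next]
    rfl

theorem received_zero {i j : Fin n} (hi : i ∈ e.group) (hj : j ∈ e.honest) :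
    d.received e 0 i j = some (d.hash e.group j i (e.prediction j)) := by
  have : j ∉ e.faulty := by simpa [Scenario.honest] using hj
  simp [received, this, sendMsg, state_zero, hi]

theorem received_one {i j : Fin n} (hj : j ∈ e.honest) (hjG : j ∈ e.group) :
    d.received e 1 i j = (d.claim e.group (d.trust e j) j).map d.name := by
  have : j ∉ e.faulty := by simpa [Scenario.honest] using hj
  simp [received, this, sendMsg, state_one, hjG]

theorem received_two {i j : Fin n} (hj : j ∈ e.honest) (hjG : j ∈ e.group) :
    d.received e 2 i j = some (d.name (d.proposal e j)) := by
  have : j ∉ e.faulty := by simpa [Scenario.honest] using hj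
  simp [received, this, sendMsg, state_two, hjG]

theorem outputs_iff (i v : Fin n) :
    d.protocol.Outputs e i v ↔ d.majority e.group i (d.received e 2 i) = v := by
  constructor
  · rintro ⟨r, hr⟩
    rcases lt_or_ge r 3 with h | h
    · interval_cases r
      · simp [protocol] at hr
        simp [Protocol.state] at hr
      · have := d.state_one e i
        simp only [protocol] at this hr
        simp [this] at hr
      · have := d.state_two e i
        simp only [protocol] at this hr
        simp [this] at hr
    · obtain ⟨r, rfl⟩ := Nat.exists_eq_add_of_le h
      have := d.state_three e r i
      simp only [protocol] at this hr
      simpa [this] using hr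
  · rintro rfl
    refine ⟨3, ?_⟩
    have := d.state_three e 0 i
    simp only [protocol, add_zero] at this ⊢
    simp [this]

theorem terminatesBy : d.protocol.TerminatesBy e 3 := by
  intro i _
  refine ⟨d.majority e.group i (d.received e 2 i), ?_⟩
  have := d.state_three e 0 i
  simp only [protocol, add_zero] at this ⊢
  simp [this]

/-- Any cost of messages that is at most `l` per message sums up to at most `3 n |G| l`. -/
theorem cost_le (l : ℕ) (w : Message → ℕ)
    (hhash : ∀ G i g a, w (d.hash G i g a) ≤ l) (hname : ∀ v, w (d.name v) ≤ l) (T : ℕ) :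
    ∑ r ∈ Finset.range T, ∑ i ∈ e.honest, ∑ j : Fin n,
      (d.protocol.send (d.protocol.state e r i) j).elim 0 w ≤ 3 * (n * e.group.card * l) := by
  classical
  set cost : ℕ → ℕ := fun r => ∑ i ∈ e.honest, ∑ j : Fin n,
      (d.protocol.send (d.protocol.state e r i) j).elim 0 w with hcost
  have h0 : cost 0 ≤ n * e.group.card * l := by
    calc cost 0 ≤ ∑ i ∈ e.honest, ∑ j : Fin n, if j ∈ e.group then l else 0 := by
          refine Finset.sum_le_sum fun i _ => Finset.sum_le_sum fun j _ => ?_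
          change (d.sendMsg (d.protocol.state e 0 i) j).elim 0 w ≤ _
          rw [state_zero]
          by_cases hj : j ∈ e.group <;> simp [sendMsg, hj, hhash]
      _ = e.honest.card * (e.group.card * l) := by simp
      _ ≤ n * (e.group.card * l) := Nat.mul_le_mul_right _ (by simpa using e.honest.card_le_univ)
      _ = _ := by ring
  have hmem : ∀ r, (∀ i j, (d.sendMsg (d.protocol.state e r i) j).elim 0 w ≤
      if i ∈ e.group then l else 0) → cost r ≤ n * e.group.card * l := by
    intro r hr
    calc cost r ≤ ∑ i ∈ e.honest, ∑ j : Fin n, if i ∈ e.group then l else 0 :=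
          Finset.sum_le_sum fun i _ => Finset.sum_le_sum fun j _ => hr i j
      _ ≤ ∑ i : Fin n, ∑ j : Fin n, if i ∈ e.group then l else 0 :=
          Finset.sum_le_sum_of_subset (Finset.subset_univ _)
      _ = _ := by simp; ring
  have h1 : cost 1 ≤ n * e.group.card * l := by
    refine hmem 1 fun i j => ?_
    rw [state_one]
    by_cases hi : i ∈ e.group
    · cases h : d.claim e.group (d.trust e i) i <;> simp [sendMsg, hi, h, hname]
    · simp [sendMsg, hi]
  have h2 : cost 2 ≤ n * e.group.card * l := by
    refine hmem 2 fun i j => ?_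
    rw [state_two]
    by_cases hi : i ∈ e.group <;> simp [sendMsg, hi, hname]
  have h3 : ∀ r, cost (3 + r) = 0 := by
    intro r
    refine Finset.sum_eq_zero fun i _ => Finset.sum_eq_zero fun j _ => ?_
    change (d.sendMsg (d.protocol.state e (3 + r) i) j).elim 0 w = 0
    rw [state_three]
    simp [sendMsg]
  calc ∑ r ∈ Finset.range T, cost r ≤ ∑ r ∈ Finset.range (3 + T), cost r :=
        Finset.sum_le_sum_of_subset (Finset.range_mono (by omega))
    _ = cost 0 + cost 1 + cost 2 := by
        rw [Finset.sum_range_add]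
        simp [h3, Finset.sum_range_succ]
    _ ≤ _ := by omega

/-- The protocol elects a leader if the honest members of the group know the honest members of
their own block, and err about few other members. -/
theorem electsLeader (U : Finset (Fin n)) (hname : Function.Injective d.name)
    (hsub : ∀ i, d.block e.group i ⊆ e.group)
    (hblock : ∀ i, ∀ j ∈ d.block e.group i, d.block e.group j = d.block e.group i)
    (hbig : ∃ i ∈ e.group, 2 * d.slack e.group + 1 ≤ (d.block e.group i ∩ e.honest).card)
    (htrust : ∀ g ∈ e.group, g ∈ e.honest →
      d.block e.group g ∩ d.trust e g = d.block e.group g ∩ e.honest)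
    (hU : U.card ≤ d.slack e.group)
    (htrustU : ∀ g ∈ e.group, g ∈ e.honest → ∀ j ∈ e.group, j ∉ U →
      (j ∈ d.trust e g ↔ j ∈ e.honest))
    (hmaj : e.group.card < 2 * (e.group ∩ e.honest).card) : d.protocol.ElectsLeader e := by
  classical
  set G := e.group with hG
  set H := e.honest with hH
  have hclaim : ∀ g ∈ G, g ∈ H → d.claim G (d.trust e g) g = d.claim G H g := by
    intro g hg hgH
    simp only [claim, htrust g hg hgH]
  set V : Finset (Fin n) := Finset.univ.filter fun v => ∃ g ∈ G, g ∈ H ∧ d.claim G H g = some v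
    with hV
  have hclaim_mem : ∀ g v, d.claim G H g = some v →
      v ∈ d.block G g ∩ H ∧ 2 * d.slack G + 1 ≤ (d.block G g ∩ H).card := by
    intro g v h
    by_cases hc : 2 * d.slack G + 1 ≤ (d.block G g ∩ H).card
    · rw [claim, if_pos hc, Option.some_inj] at h
      exact ⟨h ▸ pick_mem g (Finset.card_pos.1 (by omega)), hc⟩
    · simp [claim, hc] at h
  -- Agreement: all honest members see the same nominees, although their trust sets may differ on U.
  have hnom : ∀ i ∈ G, i ∈ H → d.nominees G (d.trust e i) (d.received e 1 i) = V := by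
    intro i hi hiH
    ext v
    simp only [nominees, hV, Finset.mem_filter, Finset.mem_univ, true_and]
    constructor
    · intro h
      -- More than `slack` nominations cannot all come from U, and a trusted nominator outside U is
      -- honest.
      obtain ⟨j, hj, hjU⟩ := Finset.exists_mem_notMem_of_card_lt_card (hU.trans_lt h)
      obtain ⟨hj, hjm⟩ := Finset.mem_filter.1 hj
      obtain ⟨hjG, hjT⟩ := Finset.mem_inter.1 hj
      have hjH : j ∈ H := (htrustU i hi hiH j hjG hjU).1 hjT
      refine ⟨j, hjG, hjH, ?_⟩
      rw [d.received_one e hjH hjG, hclaim j hjG hjH] at hjm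
      obtain ⟨v', h1, h2⟩ := Option.map_eq_some_iff.1 hjm
      rw [h1, hname h2]
    · rintro ⟨g, hg, hgH, hgv⟩
      obtain ⟨-, hc⟩ := hclaim_mem g v hgv
      have hss : (d.block G g ∩ H) \ U ⊆
          (G ∩ d.trust e i).filter fun j => d.received e 1 i j = some (d.name v) := by
        intro j hj
        obtain ⟨hj, hjU⟩ := Finset.mem_sdiff.1 hj
        obtain ⟨hjb, hjH⟩ := Finset.mem_inter.1 hj
        have hjG := hsub g hjb
        refine Finset.mem_filter.2 ⟨Finset.mem_inter.2 ⟨hjG,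
          (htrustU i hi hiH j hjG hjU).2 hjH⟩, ?_⟩
        rw [d.received_one e hjH hjG, hclaim j hjG hjH]
        have : d.claim G H j = some v := by
          rw [← hgv, claim, claim, hblock g j hjb, if_pos hc, if_pos hc,
            pick_congr j g (Finset.card_pos.1 (by omega))]
        rw [this, Option.map_some]
      have h1 := Finset.card_le_card hss
      have h2 := Finset.le_card_sdiff U (d.block G g ∩ H)
      omega
  obtain ⟨i₀, hi₀, hc₀⟩ := hbig
  obtain ⟨g₀, hg₀⟩ : (d.block G i₀ ∩ H).Nonempty := Finset.card_pos.1 (by omega)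
  obtain ⟨hg₀b, hg₀H⟩ := Finset.mem_inter.1 hg₀
  have hg₀G := hsub i₀ hg₀b
  have hVne : V.Nonempty := by
    refine ⟨pick g₀ (d.block G g₀ ∩ H), Finset.mem_filter.2 ⟨Finset.mem_univ _, g₀, hg₀G, hg₀H, ?_⟩⟩
    rw [claim, hblock i₀ g₀ hg₀b, if_pos hc₀]
  set L := pick g₀ V with hL
  have hLV : L ∈ V := pick_mem g₀ hVne
  have hLgood : L ∈ G ∧ L ∈ H := by
    obtain ⟨-, g, hg, hgH, hgv⟩ := Finset.mem_filter.1 hLV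
    have := Finset.mem_inter.1 (hclaim_mem g L hgv).1
    exact ⟨hsub g this.1, this.2⟩
  have hprop : ∀ i ∈ G, i ∈ H → d.proposal e i = L := by
    intro i hi hiH
    rw [proposal, hnom i hi hiH, pick_congr i g₀ hVne]
  have hcount : ∀ i, G.card < 2 * (G.filter fun j => d.received e 2 i j = some (d.name L)).card := by
    intro i
    refine hmaj.trans_le (Nat.mul_le_mul_left 2 (Finset.card_le_card fun j hj => ?_))
    obtain ⟨hjG, hjH⟩ := Finset.mem_inter.1 hj
    refine Finset.mem_filter.2 ⟨hjG, ?_⟩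
    rw [d.received_two e hjH hjG, hprop j hjG hjH]
  have hout : ∀ i, d.majority G i (d.received e 2 i) = L := by
    intro i
    have hex : ∃ v, G.card < 2 * (G.filter fun j => d.received e 2 i j = some (d.name v)).card :=
      ⟨L, hcount i⟩
    rw [majority, dif_pos hex]
    by_contra hne
    have hdisj : Disjoint (G.filter fun j => d.received e 2 i j = some (d.name hex.choose))
        (G.filter fun j => d.received e 2 i j = some (d.name L)) := by
      refine Finset.disjoint_left.2 fun j h1 h2 => hne ?_
      have h1 := (Finset.mem_filter.1 h1).2
      have h2 := (Finset.mem_filter.1 h2).2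
      exact hname (Option.some_inj.1 (h1.symm.trans h2))
    have h1 := Finset.card_union_of_disjoint hdisj
    have h2 := Finset.card_le_card (Finset.union_subset
      (Finset.filter_subset (fun j => d.received e 2 i j = some (d.name hex.choose)) G)
      (Finset.filter_subset (fun j => d.received e 2 i j = some (d.name L)) G))
    have h3 := hex.choose_spec
    have h4 := hcount i
    omega
  refine ⟨fun i _ => ⟨L, (d.outputs_iff e i L).2 (hout i)⟩, ?_, ?_⟩
  · intro i _ j _ u v hu hv
    rw [outputs_iff] at hu hv
    rw [← hu, ← hv, hout, hout]
  · intro i _ v hv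
    rw [outputs_iff] at hv
    rw [← hv, hout]
    exact hLgood

end Design


/-! ### Counting wrong predictions -/

namespace Scenario

variable {n : ℕ} (e : Scenario n)

/-- The processes about which `i` is wrong. -/
def rowErr (i : Fin n) : Finset (Fin n) :=
  Finset.univ.filter fun j => e.prediction i j = decide (j ∈ e.faulty)

/-- The honest processes that are wrong about `j`. -/
def colErr (j : Fin n) : Finset (Fin n) :=
  e.honest.filter fun i => e.prediction i j = decide (j ∈ e.faulty)

theorem mem_honest {i : Fin n} : i ∈ e.honest ↔ i ∉ e.faulty := by simp [honest]

theorem f_add_card_honest : e.f + e.honest.card = n := by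
  have := Finset.card_sdiff_add_card_eq_card (Finset.subset_univ e.faulty)
  simp only [Finset.card_univ, Fintype.card_fin] at this
  rw [f, honest]
  omega

theorem B_eq : e.B = ((e.honest ×ˢ (Finset.univ : Finset (Fin n))).filter
    fun p => e.prediction p.1 p.2 = decide (p.2 ∈ e.faulty)).card := by
  rw [B]
  congr 1
  refine Finset.filter_congr fun p _ => ?_
  by_cases h : p.2 ∈ e.faulty <;> simp [mem_honest, h]

theorem sum_rowErr : ∑ i ∈ e.honest, (e.rowErr i).card = e.B := by
  simp only [B_eq, Finset.card_filter, rowErr, Finset.sum_product]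

theorem sum_colErr : ∑ j, (e.colErr j).card = e.B := by
  simp only [B_eq, Finset.card_filter, colErr, Finset.sum_product_right]

variable {e}

/-- Both thresholds in `Misclassified` equal n/2 - f, so one bound serves honest and Byzantine
members alike. -/
theorem IsGood.card_colErr_lt {c : ℝ} (h : e.IsGood c) {j : Fin n} (hj : j ∈ e.group) :
    ((e.colErr j).card : ℝ) < n / 2 - e.f := by
  have h := h.1 j hj
  simp only [Misclassified, not_or, not_and, not_le] at h
  by_cases hf : j ∈ e.faulty
  · simpa [colErr, hf] using h.1 hf
  · have := h.2 (e.mem_honest.2 hf)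
    simp only [colErr, hf, decide_false]
    linarith

theorem IsGood.card_group_lt (h : e.IsGood (1 / 2)) :
    e.group.card < 2 * (e.group ∩ e.honest).card := by
  have h2 := h.2
  rw [Nat.lt_ceil] at h2
  have h3 : 2 * (e.group ∩ e.faulty).card < e.group.card := by
    have : (2 * (e.group ∩ e.faulty).card : ℝ) < e.group.card := by linarith
    exact_mod_cast this
  have h4 : e.group ∩ e.honest = e.group \ e.faulty := by
    ext j; simp [mem_honest]
  have h5 := Finset.card_sdiff_add_card_inter e.group e.faulty
  rw [h4]
  omega

/-! ### Comparing two scenarios. -/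

variable {e' : Scenario n}

theorem le_card_honest_inter : n ≤ (e.honest ∩ e'.honest).card + e.f + e'.f := by
  have h1 := e.f_add_card_honest
  have h2 := e'.f_add_card_honest
  have h3 := Finset.card_union_add_card_inter e.honest e'.honest
  have h4 : (e.honest ∪ e'.honest).card ≤ n := by simpa using (e.honest ∪ e'.honest).card_le_univ
  omega

/-- If two scenarios differ on whether `j` is Byzantine, then every common prediction about `j` is
wrong in one of them. -/
theorem card_le_of_disputed {I : Finset (Fin n)} (hI : I ⊆ e.honest ∩ e'.honest) {j : Fin n}
    (hpred : ∀ i ∈ I, e.prediction i j = e'.prediction i j)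
    (hj : ¬ (j ∈ e.honest ↔ j ∈ e'.honest)) :
    I.card ≤ (e.colErr j).card + (e'.colErr j).card := by
  refine (Finset.card_le_card fun i hi => ?_).trans (Finset.card_union_le _ _)
  have h1 := Finset.mem_inter.1 (hI hi)
  have h2 := hpred i hi
  simp only [mem_honest] at hj
  by_cases h : j ∈ e.faulty <;> by_cases h' : j ∈ e'.faulty <;>
    simp_all [colErr]

/-- At least n - f - f' processes are honest in both scenarios, and each would be wrong about a
disputed j in one of them; but the error counts are below n/2 - f and n/2 - f'. -/
theorem IsGood.honest_iff {c : ℝ} (h : e.IsGood c) (h' : e'.IsGood c) {j : Fin n}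
    (hj : j ∈ e.group) (hj' : j ∈ e'.group)
    (hpred : ∀ i ∈ e.honest ∩ e'.honest, e.prediction i j = e'.prediction i j) :
    j ∈ e.honest ↔ j ∈ e'.honest := by
  by_contra hne
  have h1 := card_le_of_disputed subset_rfl hpred hne
  have h2 := h.card_colErr_lt hj
  have h3 := h'.card_colErr_lt hj'
  have h4 := le_card_honest_inter (e := e) (e' := e')
  have h1 : ((e.honest ∩ e'.honest).card : ℝ) ≤ (e.colErr j).card + (e'.colErr j).card := by
    exact_mod_cast h1
  have h4 : (n : ℝ) ≤ (e.honest ∩ e'.honest).card + e.f + e'.f := by exact_mod_cast h4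
  linarith

/-- Markov's inequality over rows. The rows counted here are too noisy for the syndrome and get
discarded. -/
theorem card_rowErr_gt_le {ε : ℝ} {k : ℕ} (hk : 0 < k) (hB : 4 * (e.B : ℝ) ≤ ε * n * k) :
    4 * ((e.honest.filter fun i => k < (e.rowErr i).card).card : ℝ) ≤ ε * n := by
  have h1 : (e.honest.filter fun i => k < (e.rowErr i).card).card * k ≤ e.B := by
    rw [← sum_rowErr, ← smul_eq_mul]
    refine (Finset.card_nsmul_le_sum _ (fun i => (e.rowErr i).card) _ ?_).trans
      (Finset.sum_le_sum_of_subset (Finset.filter_subset _ _))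
    exact fun i hi => (Finset.mem_filter.1 hi).2.le
  have h1 : ((e.honest.filter fun i => k < (e.rowErr i).card).card : ℝ) * k ≤ e.B := by
    exact_mod_cast h1
  have hk : (0 : ℝ) < k := by exact_mod_cast hk
  nlinarith

/-- The processes about which more than `ε n / 2` honest processes are wrong. -/
noncomputable def doubtful (e : Scenario n) (ε : ℝ) : Finset (Fin n) :=
  Finset.univ.filter fun j => ε * n < 2 * ((e.colErr j).card : ℝ)

/-- Markov's inequality over columns. -/
theorem card_doubtful_le {ε : ℝ} {κ : ℕ} (hn : 0 < ε * n) (hB : 2 * (e.B : ℝ) ≤ ε * n * κ) :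
    (e.doubtful ε).card ≤ κ := by
  have h1 : ((e.doubtful ε).card : ℝ) * (ε * n) ≤ 2 * e.B := by
    rw [← sum_colErr, ← nsmul_eq_mul]
    push_cast
    rw [Finset.mul_sum]
    refine (Finset.card_nsmul_le_sum _ (fun j => 2 * ((e.colErr j).card : ℝ)) _ ?_).trans
      (Finset.sum_le_sum_of_subset_of_nonneg (Finset.subset_univ _) fun _ _ _ => by positivity)
    exact fun j hj => (Finset.mem_filter.1 hj).2.le
  have h2 : ((e.doubtful ε).card : ℝ) ≤ κ := by nlinarith
  exact_mod_cast h2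

/-- Two scenarios with the same hashes agree on the status of the members of the group that are
not doubtful. -/
theorem IsGood.honest_iff_of_hash_eq {p : ℕ} [Fact p.Prime] {m k : ℕ} {ε : ℝ} (hε : 0 < ε)
    (h' : e'.IsGood (1 / 2))
    (hf : (e.f : ℝ) < (1 / 2 - ε) * n) (hf' : (e'.f : ℝ) < (1 / 2 - ε) * n)
    (hB : 4 * (e.B : ℝ) ≤ ε * n * k) (hB' : 4 * (e'.B : ℝ) ≤ ε * n * k)
    (hk : 0 < k) (hm : 0 < m) (hεm : 1 ≤ ε * m) (hp : n * m ≤ p)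
    (hsyn : ∀ i ∈ e.honest ∩ e'.honest, syndrome (ZMod p) (4 * k) (e.prediction i) =
      syndrome (ZMod p) (4 * k) (e'.prediction i))
    (hsh : ∀ i ∈ e.honest ∩ e'.honest, share (ZMod p) m i (e.prediction i) =
      share (ZMod p) m i (e'.prediction i))
    {j : Fin n} (hj' : j ∈ e'.group) (hjd : j ∉ e.doubtful ε) :
    j ∈ e.honest ↔ j ∈ e'.honest := by
  classical
  set X := e.honest.filter fun i => k < (e.rowErr i).card with hX
  set X' := e'.honest.filter fun i => k < (e'.rowErr i).card with hX'
  set I := (e.honest ∩ e'.honest) \ (X ∪ X') with hI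
  have hIsub : I ⊆ e.honest ∩ e'.honest := Finset.sdiff_subset
  -- Each scenario discards at most εn/4 noisy rows.
  have hcard : (n : ℝ) - e.f - e'.f - ε * n / 2 ≤ I.card := by
    have h1 := Finset.le_card_sdiff (X ∪ X') (e.honest ∩ e'.honest)
    have h2 := le_card_honest_inter (e := e) (e' := e')
    have h3 := Finset.card_union_le X X'
    rw [← hI] at h1
    have h4 : n ≤ I.card + X.card + X'.card + e.f + e'.f := by omega
    have h4 : (n : ℝ) ≤ I.card + X.card + X'.card + e.f + e'.f := by exact_mod_cast h4
    have h5 := card_rowErr_gt_le hk hB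
    have h6 := card_rowErr_gt_le hk hB'
    linarith
  have hI' : ∀ i ∈ I, (e.rowErr i).card ≤ k ∧ (e'.rowErr i).card ≤ k := by
    intro i hi
    obtain ⟨h1, h2⟩ := Finset.mem_sdiff.1 hi
    obtain ⟨h3, h4⟩ := Finset.mem_inter.1 h1
    simpa [hX, hX', h3, h4] using h2
  have hn : (0 : ℝ) ≤ n := n.cast_nonneg
  have hIm : n ≤ I.card * m := by
    have hεn : 0 ≤ ε * n := mul_nonneg hε.le hn
    have : ε * n ≤ I.card := by linarith
    have : (n : ℝ) ≤ I.card * m := by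
      calc (n : ℝ) = 1 * n := by ring
        _ ≤ (ε * m) * n := mul_le_mul_of_nonneg_right hεm hn
        _ = (ε * n) * m := by ring
        _ ≤ I.card * m := mul_le_mul_of_nonneg_right this (Nat.cast_nonneg m)
    exact_mod_cast this
  have hrow : ∀ (s : Scenario n) (i i' j : Fin n), j ∉ s.rowErr i → j ∉ s.rowErr i' →
      s.prediction i j = s.prediction i' j := by
    intro s i i' j h1 h2
    simp only [rowErr, Finset.mem_filter, Finset.mem_univ, true_and] at h1 h2
    rw [Bool.eq_not_iff.2 h1, Bool.eq_not_iff.2 h2]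
  have heq : ∀ i ∈ I, e.prediction i = e'.prediction i := by
    refine eq_of_hash_eq hm hp I hIm e.prediction e'.prediction
      (fun i => e.rowErr i ∪ e'.rowErr i) (K := 4 * k) ?_ ?_
      (fun i hi => hsyn i (hIsub hi)) (fun i hi => hsh i (hIsub hi))
    -- Two rows in two scenarios with at most k errors each: hence syndromes of length 4k.
    · intro i hi i' hi'
      have h1 := Finset.card_union_le (e.rowErr i ∪ e'.rowErr i) (e.rowErr i' ∪ e'.rowErr i')
      have h2 := Finset.card_union_le (e.rowErr i) (e'.rowErr i)
      have h3 := Finset.card_union_le (e.rowErr i') (e'.rowErr i')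
      have h4 := hI' i hi
      have h5 := hI' i' hi'
      omega
    · intro i _ i' _ j hj
      simp only [Finset.mem_union, not_or] at hj
      exact ⟨hrow e i i' j hj.1.1 hj.2.1, hrow e' i i' j hj.1.2 hj.2.2⟩
  by_contra hne
  have h1 := card_le_of_disputed hIsub (fun i hi => congrFun (heq i hi) j) hne
  have h1 : (I.card : ℝ) ≤ (e.colErr j).card + (e'.colErr j).card := by exact_mod_cast h1
  -- The errors about j number at most εn/2 in `e` (not doubtful) and fewer than n/2 - f' in `e'`,
  -- whereas f < (1/2 - ε)n makes I larger than n/2 + εn/2 - f'. Doubt is measured in `e` only, so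
  -- the exceptional set is independent of `e'`.
  have h2 := h'.card_colErr_lt hj'
  simp only [doubtful, Finset.mem_filter, Finset.mem_univ, true_and, not_lt] at hjd
  nlinarith

end Scenario

/-! ### Blocks -/

section Blocks

variable {n : ℕ} (b : ℕ) (G : Finset (Fin n))

/-- The number of members of `G` before `j`. -/
def rank (j : Fin n) : ℕ := (G.filter (· < j)).card

/-- The members of `G` in the same block of `b` consecutive members as `g`. -/
def blockOf (g : Fin n) : Finset (Fin n) := G.filter fun j => rank G j / b = rank G g / b

/-- The restriction of a bit string to the block of `g`. -/
def votes (g : Fin n) (a : Fin n → Bool) : Fin b → Bool :=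
  fun s => decide (∃ j ∈ G, rank G j = b * (rank G g / b) + s ∧ a j = true)

theorem rank_lt {j : Fin n} (hj : j ∈ G) : rank G j < G.card :=
  Finset.card_lt_card (Finset.filter_ssubset.2 ⟨j, hj, lt_irrefl j⟩)

theorem rank_injOn {i j : Fin n} (hi : i ∈ G) (hj : j ∈ G) (h : rank G i = rank G j) : i = j := by
  have key : ∀ i j : Fin n, i ∈ G → i < j → rank G i < rank G j := by
    intro i j hi hij
    refine Finset.card_lt_card ⟨fun x hx => ?_, fun hs => ?_⟩
    · obtain ⟨h1, h2⟩ := Finset.mem_filter.1 hx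
      exact Finset.mem_filter.2 ⟨h1, h2.trans hij⟩
    · exact lt_irrefl i (Finset.mem_filter.1 (hs (Finset.mem_filter.2 ⟨hi, hij⟩))).2
  rcases lt_trichotomy i j with h' | h' | h'
  · exact absurd h (key i j hi h').ne
  · exact h'
  · exact absurd h (key j i hj h').ne'

variable {b G}

theorem eq_of_votes_eq (hb : 0 < b) {g : Fin n} {a a' : Fin n → Bool}
    (h : votes b G g a = votes b G g a') {j : Fin n} (hj : j ∈ blockOf b G g) : a j = a' j := by
  obtain ⟨hjG, hjb⟩ := Finset.mem_filter.1 hj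
  have key : ∀ a : Fin n → Bool,
      votes b G g a ⟨rank G j % b, Nat.mod_lt _ hb⟩ = a j := by
    intro a
    rw [votes, ← hjb]
    simp only [Nat.div_add_mod]
    cases haj : a j
    · refine decide_eq_false ?_
      rintro ⟨i, hi, hir, hai⟩
      rw [rank_injOn G hi hjG hir, haj] at hai
      exact Bool.noConfusion hai
    · exact decide_eq_true ⟨j, hjG, rfl, haj⟩
  rw [← key a, h, key a']

/-- Some block contains a substantial number of elements of a subset `S` of `G`. -/
theorem exists_card_block_inter {S : Finset (Fin n)} {κ : ℕ} (hκ : 8 * κ ≤ b)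
    (hbG : b ≤ G.card) (hS : G.card < 2 * (G ∩ S).card) :
    ∃ g ∈ G, 2 * κ + 1 ≤ (blockOf b G g ∩ S).card := by
  have hmaps : ∀ j ∈ G ∩ S, rank G j / b ∈ Finset.range (G.card / b + 1) := by
    intro j hj
    have := rank_lt G (Finset.mem_inter.1 hj).1
    exact Finset.mem_range.2 (Nat.lt_succ_of_le (Nat.div_le_div_right this.le))
  -- Pigeonhole: with at most 2κ elements per block, S would meet G in at most 2κ(|G|/b + 1) ≤ |G|/4
  -- + |G|/4 elements, by 8κ ≤ b ≤ |G|.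
  have hlt : (Finset.range (G.card / b + 1)).card * (2 * κ) < (G ∩ S).card := by
    rw [Finset.card_range]
    have h1 : 8 * κ * (G.card / b) ≤ G.card :=
      (Nat.mul_le_mul_right _ hκ).trans (Nat.mul_div_le _ _)
    nlinarith
  obtain ⟨y, -, hy⟩ := Finset.exists_lt_card_fiber_of_mul_lt_card_of_maps_to hmaps hlt
  obtain ⟨g, hg⟩ := Finset.card_pos.1 (lt_of_le_of_lt (Nat.zero_le _) hy)
  obtain ⟨hgI, hgy⟩ := Finset.mem_filter.1 hg
  refine ⟨g, (Finset.mem_inter.1 hgI).1, hy.trans_le (Finset.card_le_card fun j hj => ?_)⟩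
  obtain ⟨hjI, hjy⟩ := Finset.mem_filter.1 hj
  obtain ⟨hjG, hjS⟩ := Finset.mem_inter.1 hjI
  exact Finset.mem_inter.2 ⟨Finset.mem_filter.2 ⟨hjG, hjy.trans hgy.symm⟩, hjS⟩

end Blocks


/-! ### The main theorem -/

/-- The executions in which the protocol has to elect a leader. -/
def Scenario.Plausible {n : ℕ} (ε c D : ℝ) (e : Scenario n) : Prop :=
  e.IsGood (1 / 2) ∧ (e.f : ℝ) < (1 / 2 - ε) * (n : ℝ) ∧
    (c * Real.sqrt (n : ℝ) ≤ (e.group.card : ℝ) → (e.B : ℝ) ≤ D * (n : ℝ) ^ (3 / 2 : ℝ))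

/-- The information in the hash of a prediction string: its syndrome, its shares, and its
restriction to one block. -/
abbrev HashValue (k m b p : ℕ) : Type :=
  (Fin (4 * k) → ZMod p) × (Fin m → ZMod p) × (Fin b → Bool)

/-! ### Trusting a scenario that explains the hashes. -/

section Design

variable {n : ℕ} (ε c D : ℝ) (k m b κ p : ℕ) [Fact p.Prime]
  (enc : HashValue k m b p → Message) (name : Fin n → Message)

/-- The hash that `i` sends to the member `g` of `G`. -/
def hashMsg (G : Finset (Fin n)) (i g : Fin n) (a : Fin n → Bool) : Message :=
  enc (syndrome (ZMod p) (4 * k) a, share (ZMod p) m i a, votes b G g a)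

/-- The scenario `e` explains the messages `r` that `g` received in the first round. -/
def Explains (G : Finset (Fin n)) (g : Fin n) (r : Fin n → Option Message) (e : Scenario n) :
    Prop :=
  e.Plausible ε c D ∧ e.group = G ∧
    ∀ i ∈ e.honest, r i = some (hashMsg k m b p enc G i g (e.prediction i))

open Classical in
/-- The design in which members trust the honest processes of some scenario that explains the
hashes they received. -/
noncomputable def design : Design n where
  hash := hashMsg k m b p enc
  infer G g r := if h : ∃ e, Explains ε c D k m b p enc G g r e then h.choose.honest else ∅
  block := blockOf b
  slack G := if G.card ≤ b then 0 else κ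
  name := name

variable {ε c D k m b κ p enc name}

/-- The true scenario explains the messages, so the choice in `infer` succeeds. A process honest in
both scenarios sent one hash that fits both of its prediction strings, and `enc` is injective. -/
theorem exists_trust_eq {e : Scenario n} (he : e.Plausible ε c D) (henc : Function.Injective enc)
    {g : Fin n} (hg : g ∈ e.group) :
    ∃ e' : Scenario n, e'.Plausible ε c D ∧ e'.group = e.group ∧
      (design ε c D k m b κ p enc name).trust e g = e'.honest ∧
      ∀ i ∈ e.honest ∩ e'.honest,
        syndrome (ZMod p) (4 * k) (e.prediction i) =
          syndrome (ZMod p) (4 * k) (e'.prediction i) ∧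
        share (ZMod p) m i (e.prediction i) = share (ZMod p) m i (e'.prediction i) ∧
        votes b e.group g (e.prediction i) = votes b e.group g (e'.prediction i) := by
  set d := design ε c D k m b κ p enc name
  have hrec : ∀ i ∈ e.honest, d.received e 0 g i =
      some (hashMsg k m b p enc e.group i g (e.prediction i)) :=
    fun i hi => d.received_zero e hg hi
  have hex : ∃ e', Explains ε c D k m b p enc e.group g (d.received e 0 g) e' :=
    ⟨e, he, rfl, hrec⟩
  have ht : d.trust e g = hex.choose.honest := dif_pos hex
  obtain ⟨h1, h2, h3⟩ := hex.choose_spec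
  refine ⟨hex.choose, h1, h2, ht, fun i hi => ?_⟩
  obtain ⟨hi, hi'⟩ := Finset.mem_inter.1 hi
  have := henc (Option.some_inj.1 ((hrec i hi).symm.trans (h3 i hi')))
  simpa [Prod.ext_iff] using this

/-- If |G| ≤ b, the group is a single block, trust is exact on it, and no bound on B is needed.
Otherwise |G| ≥ c√n, so the bound on B holds in the true scenario and in every plausible one with
the same group. -/
theorem design_electsLeader {e : Scenario n} (he : e.Plausible ε c D)
    (henc : Function.Injective enc) (hname : Function.Injective name) (hε : 0 < ε) (hn : 0 < n)
    (hk : 0 < k) (hm : 0 < m) (hb : 0 < b) (hεm : 1 ≤ ε * m) (hp : n * m ≤ p)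
    (hDk : 4 * (D * (n : ℝ) ^ (3 / 2 : ℝ)) ≤ ε * n * k)
    (hDκ : 2 * (D * (n : ℝ) ^ (3 / 2 : ℝ)) ≤ ε * n * κ)
    (hcb : c * Real.sqrt n ≤ b) (hκb : 8 * κ ≤ b) :
    (design ε c D k m b κ p enc name).protocol.ElectsLeader e := by
  have hmaj := he.1.card_group_lt
  have hεn : 0 < ε * n := mul_pos hε (by exact_mod_cast hn)
  have hBbound : ∀ e' : Scenario n, e'.Plausible ε c D → b < e'.group.card →
      (e'.B : ℝ) ≤ D * (n : ℝ) ^ (3 / 2 : ℝ) := fun e' he' hbG =>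
    he'.2.2 (hcb.trans (by exact_mod_cast hbG.le))
  have htrust : ∀ g ∈ e.group, ∀ j ∈ blockOf b e.group g,
      (j ∈ (design ε c D k m b κ p enc name).trust e g ↔ j ∈ e.honest) := by
    intro g hg j hj
    obtain ⟨e', he', hG, ht, hh⟩ := exists_trust_eq (κ := κ) (name := name) he henc hg
    have hjG := (Finset.mem_filter.1 hj).1
    rw [ht]
    exact (he.1.honest_iff he'.1 hjG (hG ▸ hjG)
      fun i hi => eq_of_votes_eq hb (hh i hi).2.2 hj).symm
  refine Design.electsLeader _ e (if e.group.card ≤ b then ∅ else e.doubtful ε) hname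
    (fun i => Finset.filter_subset _ _) ?_ ?_ ?_ ?_ ?_ hmaj
  · intro i j hj
    change blockOf b e.group j = blockOf b e.group i
    rw [blockOf, (Finset.mem_filter.1 hj).2, blockOf]
  · change ∃ i ∈ e.group, 2 * (if e.group.card ≤ b then 0 else κ) + 1 ≤
      (blockOf b e.group i ∩ e.honest).card
    split_ifs with hc
    · obtain ⟨g, hg⟩ : (e.group ∩ e.honest).Nonempty := Finset.card_pos.1 (by omega)
      obtain ⟨hgG, hgH⟩ := Finset.mem_inter.1 hg
      exact ⟨g, hgG, Finset.card_pos.2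
        ⟨g, Finset.mem_inter.2 ⟨Finset.mem_filter.2 ⟨hgG, rfl⟩, hgH⟩⟩⟩
    · exact exists_card_block_inter hκb (not_le.1 hc).le hmaj
  · intro g hg _
    ext j
    simp only [Finset.mem_inter]
    exact and_congr_right fun hj => htrust g hg j hj
  · change _ ≤ if e.group.card ≤ b then 0 else κ
    split_ifs with hc
    · simp
    · have := hBbound e he (not_le.1 hc)
      exact Scenario.card_doubtful_le hεn (by linarith)
  · intro g hg _ j hj hjU
    by_cases hc : e.group.card ≤ b
    · refine htrust g hg j (Finset.mem_filter.2 ⟨hj, ?_⟩)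
      rw [Nat.div_eq_of_lt ((rank_lt _ hj).trans_le hc),
        Nat.div_eq_of_lt ((rank_lt _ hg).trans_le hc)]
    · rw [if_neg hc] at hjU
      obtain ⟨e', he', hG, ht, hh⟩ := exists_trust_eq (κ := κ) (name := name) he henc hg
      have h1 := hBbound e he (not_le.1 hc)
      have h2 := hBbound e' he' (hG ▸ not_le.1 hc)
      rw [ht]
      exact (Scenario.IsGood.honest_iff_of_hash_eq hε he'.1 he.2.1 he'.2.1 (by linarith)
        (by linarith) hk hm hεm hp (fun i hi => (hh i hi).1) (fun i hi => (hh i hi).2.1)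
        (hG ▸ hj) hjU).symm

end Design

/-! ### Trivial networks, hash length and choice of parameters. -/

/-- The protocol in which every process elects itself without communication. -/
def selfProtocol (n : ℕ) : Protocol n where
  State := Fin n
  init i _ _ := i
  send _ _ := none
  step s _ := s
  output s := some s
  output_step _ _ _ h := h

theorem selfProtocol_electsLeader {n : ℕ} (hn : n ≤ 1) (e : Scenario n) (he : e.IsGood (1 / 2)) :
    (selfProtocol n).ElectsLeader e := by
  have hsub : Subsingleton (Fin n) := Fin.subsingleton_iff_le_one.2 hn
  refine ⟨fun i _ => ⟨i, 0, rfl⟩, fun _ _ _ _ _ _ _ _ => Subsingleton.elim _ _, ?_⟩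
  intro i _ v _
  have := he.card_group_lt
  obtain ⟨g, hg⟩ : (e.group ∩ e.honest).Nonempty := Finset.card_pos.1 (by omega)
  rw [Subsingleton.elim v g]
  exact Finset.mem_inter.1 hg

/-- Since p ≤ 2nm ≤ n^(m+1), a field element takes (m+1)q bits; each of the b votes is generously
charged q bits. -/
theorem card_hashValue_le {k m b p q n : ℕ} [NeZero p] (hm : 0 < m) (hp : p ≤ 2 * (n * m))
    (hn : 2 ≤ n) (hq : n ≤ 2 ^ q) :
    Fintype.card (HashValue k m b p) ≤ 2 ^ (((4 * k + m) * (m + 1) + b) * q) := by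
  have hq0 : 1 ≤ q := by
    by_contra h
    have : q = 0 := by omega
    simp [this] at hq
    omega
  have hmpow : 2 * m ≤ n ^ m := by
    calc 2 * m ≤ 2 ^ m := by
          obtain ⟨m, rfl⟩ := Nat.exists_eq_add_of_le hm
          have := Nat.lt_two_pow_self (n := m)
          rw [pow_add]
          omega
      _ ≤ n ^ m := Nat.pow_le_pow_left hn m
  have hp' : p ≤ 2 ^ (q * (m + 1)) := by
    calc p ≤ 2 * (n * m) := hp
      _ = n * (2 * m) := by ring
      _ ≤ n * n ^ m := Nat.mul_le_mul_left _ hmpow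
      _ = n ^ (m + 1) := by rw [pow_succ']
      _ ≤ (2 ^ q) ^ (m + 1) := Nat.pow_le_pow_left hq _
      _ = _ := by rw [← pow_mul]
  calc Fintype.card (HashValue k m b p) = p ^ (4 * k + m) * 2 ^ b := by
        simp [HashValue, ZMod.card, pow_add, mul_assoc]
    _ ≤ (2 ^ (q * (m + 1))) ^ (4 * k + m) * 2 ^ (b * q) :=
        Nat.mul_le_mul (Nat.pow_le_pow_left hp' _)
          (Nat.pow_le_pow_right (by norm_num) (Nat.le_mul_of_pos_right b hq0))
    _ = _ := by rw [← pow_mul, ← pow_add]; congr 1; ring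

theorem log_two_add_one_le {n : ℕ} (hn : 2 ≤ n) : ((Nat.log 2 n + 1 : ℕ) : ℝ) ≤ 4 * Real.log n := by
  have h2 := Real.log_two_gt_d9
  have hlog : Real.log 2 ≤ Real.log n := Real.log_le_log (by norm_num) (by exact_mod_cast hn)
  have h1 : (Nat.log 2 n : ℝ) ≤ Real.logb 2 n := by exact_mod_cast Real.natLog_le_logb n 2
  have h3 : Real.logb 2 n ≤ 2 * Real.log n := by
    rw [Real.logb, div_le_iff₀ (by linarith)]
    nlinarith
  push_cast
  linarith

/-- The parameters k, κ and b are of order √n, while m depends on ε alone. The two Markov bounds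
dictate k and κ; m ≥ 1/ε lets εn processes supply n evaluation points; b ≥ 8κ serves the pigeonhole,
and b ≥ c√n makes every group larger than a block subject to the bound on B. -/
theorem exists_protocol {n : ℕ} (hn : 2 ≤ n) {ε c D : ℝ} (hε : 0 < ε) (hc : 0 < c) (hD : 0 < D) :
    ∃ (d : Design n) (l : ℕ), (∀ G i g a, (d.hash G i g a).length ≤ l) ∧
      (∀ v, (d.name v).length ≤ l) ∧
      ((l : ℝ) ≤ ((4 * (4 * D / ε + 2) + (⌈1 / ε⌉₊ + 1)) * (⌈1 / ε⌉₊ + 2) +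
        (8 * (2 * D / ε + 1) + c + 2)) * Real.sqrt n * (4 * Real.log n)) ∧
      ∀ e : Scenario n, e.Plausible ε c D → d.protocol.ElectsLeader e := by
  have hn1 : (1 : ℝ) ≤ n := by exact_mod_cast (by omega : 1 ≤ n)
  set s := Real.sqrt n with hs
  have hs1 : 1 ≤ s := Real.one_le_sqrt.2 hn1
  have hpow : (n : ℝ) ^ (3 / 2 : ℝ) = n * s := by
    rw [hs, Real.sqrt_eq_rpow, ← Real.rpow_one_add' (by positivity) (by norm_num)]
    norm_num
  set k := ⌈4 * D / ε * s⌉₊ + 1 with hk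
  set κ := ⌈2 * D / ε * s⌉₊ with hκ
  set m := ⌈1 / ε⌉₊ + 1 with hm
  set b := 8 * κ + ⌈c * s⌉₊ + 1 with hb
  set q := Nat.log 2 n + 1 with hq
  have hnq : n ≤ 2 ^ q := (Nat.lt_pow_succ_log_self (by norm_num) n).le
  have hm0 : 0 < m := Nat.succ_pos _
  -- Bertrand's postulate: a field with room for n m points whose elements still have short
  -- encodings.
  obtain ⟨p, hpp, hp1, hp2⟩ := Nat.exists_prime_lt_and_le_two_mul (n * m)
    (Nat.mul_pos (by omega) hm0).ne'
  have : Fact p.Prime := ⟨hpp⟩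
  set A := (4 * k + m) * (m + 1) + b with hA
  have hA1 : 1 ≤ A := by omega
  obtain ⟨enc, henc, hencl⟩ := exists_encoding (HashValue k m b p) (A * q)
    (card_hashValue_le hm0 hp2 hn hnq)
  obtain ⟨name, hname, hnamel⟩ := exists_encoding (Fin n) (A * q) (by
    rw [Fintype.card_fin]
    exact hnq.trans (Nat.pow_le_pow_right (by norm_num) (Nat.le_mul_of_pos_left q hA1)))
  have h4 : 4 * D / ε * s ≤ k := by
    rw [hk]; push_cast
    linarith [Nat.le_ceil (4 * D / ε * s)]
  have h2 : 2 * D / ε * s ≤ κ := Nat.le_ceil _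
  refine ⟨design ε c D k m b κ p enc name, A * q, fun G i g a => (hencl _).le,
    fun v => (hnamel v).le, ?_, fun e he => ?_⟩
  · have hkle : (k : ℝ) ≤ (4 * D / ε + 2) * s := by
      have := Nat.ceil_lt_add_one (a := 4 * D / ε * s) (by positivity)
      rw [hk]; push_cast
      nlinarith
    have hκle : (κ : ℝ) ≤ (2 * D / ε + 1) * s := by
      have := Nat.ceil_lt_add_one (a := 2 * D / ε * s) (by positivity)
      nlinarith
    have hble : (b : ℝ) ≤ (8 * (2 * D / ε + 1) + c + 2) * s := by
      have := Nat.ceil_lt_add_one (a := c * s) (by positivity)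
      rw [hb]; push_cast
      nlinarith
    have hmr : (m : ℝ) = (⌈1 / ε⌉₊ : ℝ) + 1 := by rw [hm]; push_cast; ring
    have hmr' : (⌈1 / ε⌉₊ : ℝ) + 2 = m + 1 := by rw [hmr]; ring
    rw [← hmr, hmr']
    have hm0' : (0 : ℝ) ≤ m := m.cast_nonneg
    have hAle : (A : ℝ) ≤ ((4 * (4 * D / ε + 2) + m) * (m + 1) +
        (8 * (2 * D / ε + 1) + c + 2)) * s := by
      have h1 : 4 * (k : ℝ) + m ≤ (4 * (4 * D / ε + 2) + m) * s := by nlinarith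
      have h2 := mul_le_mul_of_nonneg_right h1 (by linarith : (0 : ℝ) ≤ (m : ℝ) + 1)
      rw [hA]; push_cast
      linarith
    have hqle := log_two_add_one_le hn
    rw [← hq] at hqle
    rw [Nat.cast_mul]
    exact mul_le_mul hAle hqle q.cast_nonneg (by positivity)
  · refine design_electsLeader he henc hname hε (by omega) (Nat.succ_pos _) hm0 (Nat.succ_pos _)
      ?_ hp1.le ?_ ?_ ?_ (by omega)
    · have h1 := Nat.le_ceil (1 / ε)
      have : 1 / ε ≤ m := by rw [hm]; push_cast; linarith
      rwa [div_le_iff₀' hε] at this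
    · rw [hpow]
      calc 4 * (D * (n * s)) = ε * n * (4 * D / ε * s) := by field_simp
        _ ≤ ε * n * k := mul_le_mul_of_nonneg_left h4 (by positivity)
    · rw [hpow]
      calc 2 * (D * (n * s)) = ε * n * (2 * D / ε * s) := by field_simp
        _ ≤ ε * n * κ := mul_le_mul_of_nonneg_left h2 (by positivity)
    · have h1 := Nat.le_ceil (c * s)
      have h5 : (⌈c * s⌉₊ : ℝ) ≤ b := by exact_mod_cast (by omega : ⌈c * s⌉₊ ≤ b)
      exact h1.trans h5

end ByzPred

theorem mainTheorem4 :
    ∃ (R : ℕ) (M : ℝ), ∀ (ε c D : ℝ), 0 < ε → ε < 1 / 2 → 0 < c → 0 < D →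
      ∃ (K : ℝ) (P : (n : ℕ) → ByzPred.Protocol n), ∀ (n : ℕ) (e : ByzPred.Scenario n),
        (P n).TerminatesBy e R ∧
        (∀ T : ℕ, ((P n).messages e T : ℝ) ≤ M * ((n : ℝ) * (e.group.card : ℝ))) ∧
        (∀ T : ℕ, ((P n).bits e T : ℝ) ≤
          K * ((n : ℝ) ^ (3 / 2 : ℝ) * (e.group.card : ℝ) * Real.log (n : ℝ))) ∧
        (e.IsGood (1 / 2) →
          (e.f : ℝ) < (1 / 2 - ε) * (n : ℝ) →
          (c * Real.sqrt (n : ℝ) ≤ (e.group.card : ℝ) →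
            (e.B : ℝ) ≤ D * (n : ℝ) ^ (3 / 2 : ℝ)) →
          (P n).ElectsLeader e) := by
  classical
  refine ⟨3, 3, fun ε c D hε _ hc hD => ?_⟩
  choose d l hhash hname hl hd using fun (n : ℕ) (hn : 2 ≤ n) =>
    ByzPred.exists_protocol hn hε hc hD
  set A : ℝ := (4 * (4 * D / ε + 2) + (⌈1 / ε⌉₊ + 1)) * (⌈1 / ε⌉₊ + 2) +
    (8 * (2 * D / ε + 1) + c + 2) with hA
  have hA0 : 0 ≤ A := by positivity
  -- The 12 is three rounds times the 4 from `log_two_add_one_le`. For n ≤ 1 the factor log n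
  -- vanishes, so only a silent protocol meets the bit bound.
  refine ⟨12 * A, fun n => if hn : 2 ≤ n then (d n hn).protocol else ByzPred.selfProtocol n,
    fun n e => ?_⟩
  by_cases hn : 2 ≤ n
  · simp only [dif_pos hn]
    refine ⟨(d n hn).terminatesBy e, fun T => ?_, fun T => ?_, fun h1 h2 h3 => ?_⟩
    · have := (d n hn).cost_le e 1 (fun _ => 1) (fun _ _ _ _ => le_rfl) (fun _ => le_rfl) T
      rw [mul_one] at this
      exact_mod_cast this
    · have h1 := (d n hn).cost_le e (l n hn) List.length (hhash n hn) (hname n hn) T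
      have h1 : ((d n hn).protocol.bits e T : ℝ) ≤ 3 * (n * e.group.card * l n hn) := by
        exact_mod_cast h1
      have hpow : (n : ℝ) ^ (3 / 2 : ℝ) = n * Real.sqrt n := by
        rw [Real.sqrt_eq_rpow, ← Real.rpow_one_add' (by positivity) (by norm_num)]
        norm_num
      have h2 := mul_le_mul_of_nonneg_left (hl n hn)
        (by positivity : (0 : ℝ) ≤ n * e.group.card)
      rw [hpow]
      calc ((d n hn).protocol.bits e T : ℝ) ≤ 3 * (n * e.group.card * l n hn) := h1
        _ ≤ 3 * (n * e.group.card * (A * Real.sqrt n * (4 * Real.log n))) := by linarith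
        _ = _ := by ring
    · exact hd n hn e ⟨h1, h2, h3⟩
  · simp only [dif_neg hn]
    have hlog : 0 ≤ Real.log (n : ℝ) := Real.log_natCast_nonneg n
    refine ⟨fun i _ => ⟨_, rfl⟩, fun T => ?_, fun T => ?_, fun h1 _ _ =>
      ByzPred.selfProtocol_electsLeader (by omega) e h1⟩
    · simp only [ByzPred.Protocol.messages, ByzPred.selfProtocol, Option.elim_none,
        Finset.sum_const_zero, Nat.cast_zero]
      positivity
    · simp only [ByzPred.Protocol.bits, ByzPred.selfProtocol, Option.elim_none,
        Finset.sum_const_zero, Nat.cast_zero]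
      positivity
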